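/- Let $(G,T)$ be a GBS system, that is, $G$ is a finitely generated group acting by graph automorphisms on a tree $T$ such that every vertex stabiliser and every edge stabiliser is infinite cyclic. Let $\phi\in\operatorname{Aut}^T(G)$; that is, $\phi$ is an automorphism of $G$ for which there is a graph automorphism of $T$, $x\mapsto\phi\cdot x$, with $\phi\cdot(gx)=\phi(g)(\phi\cdot x)$ for all $g\in G$ and $x\in T$; fix such an action of $\phi$ on $T$. Suppose that $\operatorname{sgn}(\phi)=-1$, that is, $\phi$ fixes a point of (the geometric realisation of) $T$, and for no point $x\in T$ with $\phi\cdot x=x$ does $\phi$ restrict to the identity on the stabiliser $G_x$ (equivalently, $\phi$ acts as inversion on $G_x\cong\mathbb{Z}$ for every fixed point $x$). Then the fixed subgroup $\operatorname{Fix}(\phi)=\{g\in G\mid\phi(g)=g\}$ is a finitely generated free group, of rank (minimal cardinality of a generating set) at most $2|E(T/G)|$, where $|E(T/G)|\in\mathbb{N}\cup\{\infty\}$ is the number of $G$-orbits of edges of $T$. -/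

import Mathlib

namespace GBS

section Defs

variable {G V : Type*} [Group G] [MulAction G V]

/-- The induced action of `G` on unordered pairs of vertices: `g • s(u, v) = s(g • u, g • v)`. -/
instance sym2Action : MulAction G (Sym2 V) where
  smul g e := e.map (g • ·)
  one_smul e := by
    induction e with
    | _ u v => exact congrArg₂ (fun a b => s(a, b)) (one_smul G u) (one_smul G v)
  mul_smul g h e := by
    induction e with
    | _ u v => exact congrArg₂ (fun a b => s(a, b)) (mul_smul g h u) (mul_smul g h v)

/-- A GBS system `(G, T)`: a finitely generated group `G` acting by graph automorphisms on a tree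
`T` such that all vertex stabilisers and all edge stabilisers are infinite cyclic.
The stabiliser of an edge is its setwise stabiliser (if `G` acts without inversions, this is the
same as the pointwise stabiliser). -/
structure IsGBSSystem (G : Type*) {V : Type*} [Group G] [MulAction G V]
    (T : SimpleGraph V) : Prop where
  fg : Group.FG G
  isTree : T.IsTree
  adj_smul : ∀ (g : G) (u v : V), T.Adj u v → T.Adj (g • u) (g • v)
  vertex_cyclic : ∀ v : V, IsCyclic (MulAction.stabilizer G v)
  vertex_infinite : ∀ v : V, Infinite (MulAction.stabilizer G v)
  edge_cyclic : ∀ e ∈ T.edgeSet, IsCyclic (MulAction.stabilizer G e)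
  edge_infinite : ∀ e ∈ T.edgeSet, Infinite (MulAction.stabilizer G e)

/-- The number `|E(T/G)|` of edges of the quotient graph `T/G`, that is, the number of `G`-orbits
of edges of `T` (possibly infinite). -/
noncomputable def numQuotientEdges (G : Type*) {V : Type*} [Group G] [MulAction G V]
    (T : SimpleGraph V) : ℕ∞ :=
  (MulAction.orbit G '' T.edgeSet).encard

/-- The tree automorphism `f` is `φ`-equivariant, i.e. it is an equivariant isomorphism from `T`
to `T` with the action precomposed with `φ`. The automorphism `φ` lies in `Aut^T(G)` exactly when
such an `f` exists, and `f` is then the action of `φ` on `T`. -/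
def IsEquivariant {T : SimpleGraph V} (φ : MulAut G) (f : T ≃g T) : Prop :=
  ∀ (g : G) (v : V), f (g • v) = φ g • f v

/-- `f` fixes a point of the (geometric realisation of the) tree `T`: it fixes a vertex, or it maps
an edge to itself and hence fixes the midpoint of that edge. -/
def FixesPoint {T : SimpleGraph V} (f : T ≃g T) : Prop :=
  (∃ v : V, f v = v) ∨ ∃ e ∈ T.edgeSet, e.map f = e

/-- There is a point `x` of `T` (a vertex or the midpoint of an edge) fixed by `f` such that `φ`
restricts to the identity on the stabiliser `G_x`. The stabiliser of the midpoint of an edge is the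
stabiliser of the edge. -/
def IsIdOnStabilizer {T : SimpleGraph V} (φ : MulAut G) (f : T ≃g T) : Prop :=
  (∃ v : V, f v = v ∧ ∀ g ∈ MulAction.stabilizer G v, φ g = g) ∨
    ∃ e ∈ T.edgeSet, e.map f = e ∧ ∀ g ∈ MulAction.stabilizer G e, φ g = g

open Classical in
/-- The sign of `φ`, acting on the tree `T` through `f`. If `f` fixes a point of `T`, the sign is
`1` if `φ` is the identity on the stabiliser of some point fixed by `f`, and `-1` otherwise.
If `f` does not fix a point, then the sign is undefined, i.e. `none`. -/
noncomputable def sgn {T : SimpleGraph V} (φ : MulAut G) (f : T ≃g T) : Option ℤˣ :=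
  if FixesPoint f then some (if IsIdOnStabilizer φ f then 1 else -1) else none

/-- The fixed subgroup `Fix(φ) = {g ∈ G | φ(g) = g}`. -/
def fixedSubgroup (φ : MulAut G) : Subgroup G :=
  φ.toMonoidHom.eqLocus (MonoidHom.id G)

end Defs

end GBS

/-!
The group `Fix(φ)` preserves the set of points of `T` fixed by `f`. If an automorphism preserves an
infinite cyclic group, it is the identity or inversion there, so the hypothesis on the sign says
that `φ` inverts the stabiliser of every fixed vertex and of every fixed edge; hence `Fix(φ)` meets
these stabilisers trivially (`eq_one_of_mem_of_apply_eq`).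

If `f` fixes a vertex `v`, then `Fix(φ)` acts freely and without inversions on the subtree of fixed
vertices, so it is free. Freeness is obtained by reading off the darts of the path from a base
vertex `r` to `g • r`, up to the action: the resulting word is reduced, so the group embeds in a
free group, and the Nielsen–Schreier theorem applies (`isFreeGroup_of_free_action`). The group is
generated by one element for each orbit of edges (`exists_closure_eq_top_of_free_action`).

The orbits of edges are counted in `exists_colour_fixed_edges`. Let `f` fix the edges `b` and
`g • b`. Then `g⁻¹ * φ g` lies in the stabiliser of `b`, and since `φ` inverts this stabiliser, a
change of `g` by an element of the stabiliser multiplies `g⁻¹ * φ g` by a square. So a `G`-orbit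
contains at most two `Fix(φ)`-orbits of fixed edges, according to the parity of an exponent.

As `T/G` may be infinite, `T` is replaced by the union of the translates of the walks from `v` to
`s • v`, with `s` in a finite generating set of `G` (`exists_finite_orbitSubgraph_reachable`). This
subtree has finitely many orbits of edges, which makes `Fix(φ)` finitely generated.

If `f` fixes no vertex, it inverts an edge. A tree automorphism inverts at most one edge
(`eq_of_inverted`), so `Fix(φ)` preserves that edge and is trivial.
-/

namespace TreeAction

open SimpleGraph MulAction

/-! ### Groups acting freely on trees -/

section FreeAction

variable {F W H : Type*} [Group F] [MulAction F W] [Group H] {Y : SimpleGraph W}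

/-- A group-valued labelling of the darts of a tree, inverted by reversal of darts, is the
coboundary of a function on the vertices: multiply the labels along the path from the root `r`. -/
theorem exists_potential (hY : Y.IsTree) (l : W → W → H)
    (hl : ∀ a b, Y.Adj a b → l b a = (l a b)⁻¹) (r : W) :
    ∃ P : W → H,
      (∀ w (p : Y.Walk r w), p.IsPath → P w = (p.darts.map fun d => l d.fst d.snd).prod) ∧
      ∀ a b, Y.Adj a b → P b = P a * l a b := by
  choose q hq hu using hY.existsUnique_path r
  have key : ∀ a b (hab : Y.Adj a b), a ∈ (q b).support →
      ((q b).darts.map fun d => l d.fst d.snd).prod =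
        ((q a).darts.map fun d => l d.fst d.snd).prod * l a b := by
    intro a b hab ha
    rw [hY.isAcyclic.path_concat (hq a) (hq b) hab ha]
    simp [Walk.darts_concat]
  refine ⟨fun w => ((q w).darts.map fun d => l d.fst d.snd).prod, ?_, ?_⟩
  · intro w p hp
    rw [hu w p hp]
  · intro a b hab
    -- One of the paths to `a` and to `b` extends the other by the edge between them.
    by_cases ha : a ∈ (q b).support
    · exact key a b hab ha
    · have hb := hY.isAcyclic.mem_support_of_ne_mem_support_of_adj_of_isPath (hq a) (hq b) hab ha
      simp only [key b a hab.symm hb, hl a b hab, inv_mul_cancel_right]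

/-- A function on the vertices of a connected graph is determined by its coboundary and its value
at one vertex. -/
theorem potential_unique (hY : Y.Connected) (l : W → W → H) {P Q : W → H} {r : W}
    (hr : P r = Q r) (hP : ∀ a b, Y.Adj a b → P b = P a * l a b)
    (hQ : ∀ a b, Y.Adj a b → Q b = Q a * l a b) : P = Q := by
  funext w
  obtain ⟨p⟩ := hY.preconnected r w
  induction p with
  | nil => exact hr
  | cons h _ ih => exact ih (by rw [hP _ _ h, hQ _ _ h, hr])

open Classical in
/-- The label of the dart from `a` to `b` in the free group on the orbits of pairs of vertices. Of
the orbits of `(a, b)` and of `(b, a)`, the smaller one in a well-order is used as a generator; the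
label is this generator or its inverse. -/
noncomputable def dartLabel (F : Type*) {W : Type*} [Group F] [MulAction F W] (a b : W) :
    Set (W × W) × Bool :=
  if WellOrderingRel (orbit F (a, b)) (orbit F (b, a)) then (orbit F (a, b), true)
  else (orbit F (b, a), false)

theorem dartLabel_smul (g : F) (a b : W) : dartLabel F (g • a) (g • b) = dartLabel F a b := by
  have h (x y : W) : orbit F (g • x, g • y) = orbit F (x, y) := orbit_smul g (x, y)
  unfold dartLabel
  rw [h, h]

theorem dartLabel_swap {a b : W} (h : orbit F (a, b) ≠ orbit F (b, a)) :
    dartLabel F b a = ((dartLabel F a b).1, !(dartLabel F a b).2) := by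
  unfold dartLabel
  rcases trichotomous_of WellOrderingRel (orbit F (a, b)) (orbit F (b, a)) with h1 | h1 | h1
  · simp [h1, asymm h1]
  · exact absurd h1 h
  · simp [h1, asymm h1]

theorem orbit_swap_eq {a b c d : W} (h : orbit F (a, b) = orbit F (c, d)) :
    orbit F (b, a) = orbit F (d, c) := by
  obtain ⟨g, hg⟩ := orbit_eq_iff.mp h
  exact orbit_eq_iff.mpr ⟨g, Prod.ext (congrArg Prod.snd hg) (congrArg Prod.fst hg)⟩

/-- Darts whose labels are inverse to each other are related by an element of `F` and a
reversal. -/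
theorem orbit_eq_of_dartLabel_eq_not {a b c d : W}
    (h₁ : (dartLabel F a b).1 = (dartLabel F c d).1)
    (h₂ : (dartLabel F a b).2 ≠ (dartLabel F c d).2) : orbit F (a, b) = orbit F (d, c) := by
  unfold dartLabel at h₁ h₂
  split_ifs at h₁ h₂
  · exact absurd rfl h₂
  · exact h₁
  · exact orbit_swap_eq h₁
  · exact absurd rfl h₂

/-- The product of the labels along a path is a reduced word: if the labels of consecutive darts
`a → b → c` cancel, an element of `F` fixes `b` and takes `a` to `c`, so `a = c`. Hence the
labelling embeds `F` in a free group, and the Nielsen–Schreier theorem applies. -/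
theorem isFreeGroup_of_free_action (hY : Y.IsTree)
    (hadj : ∀ (g : F) u v, Y.Adj u v → Y.Adj (g • u) (g • v))
    (hfree : ∀ (g : F) (w : W), g • w = w → g = 1)
    (hinv : ∀ (g : F) u v, Y.Adj u v → g • u = v → g • v ≠ u) : IsFreeGroup F := by
  obtain ⟨r⟩ := hY.connected.nonempty
  let l : W → W → FreeGroup (Set (W × W)) := fun a b => FreeGroup.mk [dartLabel F a b]
  have hl : ∀ a b, Y.Adj a b → l b a = (l a b)⁻¹ := by
    intro a b hab
    have hne : orbit F (a, b) ≠ orbit F (b, a) := by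
      intro h
      obtain ⟨g, hg⟩ := orbit_eq_iff.mp h
      exact hinv g b a hab.symm (congrArg Prod.fst hg) (congrArg Prod.snd hg)
    simp [l, dartLabel_swap hne, FreeGroup.inv_mk, FreeGroup.invRev]
  obtain ⟨P, hP, hstep⟩ := exists_potential hY l hl r
  have hPr : P r = 1 := by simpa using hP r Walk.nil (by simp)
  have hmul : ∀ (g : F) w, P (g • w) = P (g • r) * P w := by
    -- Both sides are functions of `w` with coboundary `l` and the same value at `r`.
    intro g w
    refine congrFun (potential_unique hY.connected l (r := r) (P := fun w => P (g • w))
      (Q := fun w => P (g • r) * P w) (by simp [hPr]) ?_ ?_) w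
    · intro a b hab
      rw [hstep _ _ (hadj g a b hab)]
      simp only [l, dartLabel_smul]
    · intro a b hab
      simp only [hstep _ _ hab, mul_assoc]
  let Φ : F →* FreeGroup (Set (W × W)) :=
    { toFun g := P (g • r)
      map_one' := by simpa using hPr
      map_mul' g h := by rw [mul_smul, hmul] }
  have hinj : Function.Injective Φ := by
    rw [injective_iff_map_eq_one]
    intro g hg
    obtain ⟨p, hp, -⟩ := hY.existsUnique_path r (g • r)
    have hword : FreeGroup.mk (p.darts.map fun d => dartLabel F d.fst d.snd) = 1 := by
      rw [← hg]
      change _ = P (g • r)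
      rw [hP _ p hp]
      generalize p.darts = L
      induction L with
      | nil => rfl
      | cons d L ih =>
        rw [List.map_cons, List.map_cons, List.prod_cons, ← ih, FreeGroup.mul_mk]
        rfl
    have hred : FreeGroup.IsReduced (p.darts.map fun d => dartLabel F d.fst d.snd) := by
      have hchain := p.isChain_dartAdj_darts
      have hedges := (hY.isAcyclic.isPath_iff_isChain p).mp hp
      rw [Walk.edges, List.isChain_map, List.isChain_iff_getElem] at hedges
      rw [List.isChain_iff_getElem] at hchain
      rw [FreeGroup.IsReduced, List.isChain_map, List.isChain_iff_getElem]
      intro i hi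
      have hadj' := hchain i hi
      have hne := hedges i hi
      generalize p.darts[i] = d at hadj' hne ⊢
      generalize p.darts[i + 1] = d' at hadj' hne ⊢
      obtain ⟨⟨a, b⟩, hab⟩ := d
      obtain ⟨⟨b', c⟩, hbc⟩ := d'
      intro h₁
      obtain rfl : b = b' := hadj'
      by_contra h₂
      obtain ⟨k, hk⟩ := orbit_eq_iff.mp (orbit_eq_of_dartLabel_eq_not h₁ h₂)
      obtain rfl : k = 1 := hfree k _ (congrArg Prod.snd hk)
      obtain rfl : c = a := by simpa using congrArg Prod.fst hk
      exact hne (by simp [Sym2.eq_swap])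
    have hnil : (p.darts.map fun d => dartLabel F d.fst d.snd) = [] := by
      rw [← hred.reduce_eq, ← FreeGroup.toWord_mk, hword, FreeGroup.toWord_one]
    have hlen : p.length = 0 := by
      rw [← Walk.length_darts, ← List.length_map (f := fun d => dartLabel F d.fst d.snd), hnil]
      rfl
    exact hfree g r (Walk.eq_of_length_eq_zero hlen).symm
  obtain ⟨ι, ⟨b⟩⟩ := (inferInstance : IsFreeGroup Φ.range).nonempty_basis
  exact (b.map (Φ.ofInjective hinj).symm).isFreeGroup

/-- A vertex `w` is `γ w` times the representative of its orbit. The elements `(γ a)⁻¹ * γ b` for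
edges `s(a, b)` generate by connectedness, and depend up to inversion only on the orbit of the
edge. -/
theorem exists_closure_eq_top_of_free_action (hY : Y.Connected)
    (hfree : ∀ (g : F) (w : W), g • w = w → g = 1) :
    ∃ S : Set F, Subgroup.closure S = ⊤ ∧ S.encard ≤ GBS.numQuotientEdges F Y := by
  have hrep : ∀ w : W, ∃ g : F, g • (Quotient.mk (orbitRel F W) w).out = w := fun w =>
    (Quotient.exact (Quotient.out_eq (Quotient.mk (orbitRel F W) w)).symm)
  choose γ hγ using hrep
  have hγ_smul : ∀ (g : F) (w : W), γ (g • w) = g * γ w := by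
    intro g w
    have hq : Quotient.mk (orbitRel F W) (g • w) = Quotient.mk (orbitRel F W) w :=
      Quotient.sound ⟨g, rfl⟩
    have h := hγ (g • w)
    rw [hq] at h
    have h' : ((g * γ w)⁻¹ * γ (g • w)) • (Quotient.mk (orbitRel F W) w).out =
        (Quotient.mk (orbitRel F W) w).out := by
      rw [mul_smul, h, inv_smul_eq_iff, mul_smul, hγ]
    exact (inv_mul_eq_one.mp (hfree _ _ h')).symm
  have hout : ∀ e : Sym2 W, ∃ a b, s(a, b) = e := fun e => by
    induction e with
    | _ a b => exact ⟨a, b, rfl⟩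
  choose src tgt hst using hout
  let E : Set (Set (Sym2 W)) := orbit F '' Y.edgeSet
  obtain ⟨r⟩ := hY.nonempty
  have : Nonempty (Sym2 W) := ⟨s(r, r)⟩
  let pick : Set (Sym2 W) → Sym2 W := fun o => Classical.epsilon (· ∈ o)
  let δ : Set (Sym2 W) → F := fun o => (γ (src (pick o)))⁻¹ * γ (tgt (pick o))
  refine ⟨δ '' E, ?_, Set.encard_image_le _ _⟩
  have hedge : ∀ a b, Y.Adj a b → (γ a)⁻¹ * γ b ∈ Subgroup.closure (δ '' E) := by
    intro a b hab
    have hmem : δ (orbit F s(a, b)) ∈ Subgroup.closure (δ '' E) :=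
      Subgroup.subset_closure ⟨_, ⟨s(a, b), hab, rfl⟩, rfl⟩
    have hpick : pick (orbit F s(a, b)) ∈ orbit F s(a, b) :=
      Classical.epsilon_spec (p := (· ∈ orbit F s(a, b))) ⟨s(a, b), mem_orbit_self _⟩
    obtain ⟨g, hg⟩ := hpick
    have hg' : s(g • a, g • b) = s(src (pick (orbit F s(a, b))), tgt (pick (orbit F s(a, b)))) := by
      rw [hst]; exact hg
    rcases Sym2.eq_iff.mp hg' with ⟨h₁, h₂⟩ | ⟨h₁, h₂⟩
    · simpa only [δ, ← h₁, ← h₂, hγ_smul, mul_inv_rev, mul_assoc, inv_mul_cancel_left] using hmem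
    · have := inv_mem hmem
      simpa only [δ, ← h₁, ← h₂, hγ_smul, mul_inv_rev, mul_assoc, inv_mul_cancel_left,
        inv_inv] using this
  have hwalk : ∀ {u w : W} (p : Y.Walk u w), (γ u)⁻¹ * γ w ∈ Subgroup.closure (δ '' E) := by
    intro u w p
    induction p with
    | nil => simp
    | cons h _ ih => simpa [mul_assoc] using mul_mem (hedge _ _ h) ih
  rw [eq_top_iff]
  intro g _
  -- Since `γ (k • r) = k * γ r`, the walk from `r` to `k • r` yields the conjugate of `k` by `γ r`.
  obtain ⟨p⟩ := hY.preconnected r ((γ r * g * (γ r)⁻¹) • r)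
  simpa [hγ_smul, mul_assoc] using hwalk p

end FreeAction

/-! ### Tree automorphisms and cocompact subgraphs -/

section Graph

variable {G V : Type*} [Group G] [MulAction G V] {T : SimpleGraph V}

/-- An automorphism of a tree that fixes two vertices fixes the path between them. -/
theorem apply_eq_of_mem_path_support (hT : T.IsAcyclic) (f : T ≃g T) {u w : V} (hu : f u = u)
    (hw : f w = w) {p : T.Walk u w} (hp : p.IsPath) {x : V} (hx : x ∈ p.support) : f x = x := by
  have hmap : ((p.map f.toHom).copy hu hw).IsPath := by
    simpa using hp.map f.injective
  have heq : (p.map f.toHom).copy hu hw = p :=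
    congrArg Subtype.val ((hT.subsingleton_path u w).elim ⟨_, hmap⟩ ⟨p, hp⟩)
  obtain ⟨n, rfl, -⟩ := Walk.mem_support_iff_exists_getVert.mp hx
  have := congrArg (fun q => q.getVert n) heq
  simpa using this

/-- An edge of a tree that is inverted by an automorphism is the only such edge: deletion of
the edge `s(u, w)` leaves two components, which are interchanged, so another inverted edge would
connect them. -/
theorem eq_of_inverted (hT : T.IsAcyclic) (hc : T.Connected) (f : T ≃g T) {u w u' w' : V}
    (h : T.Adj u w) (hu : f u = w) (hw : f w = u) (h' : T.Adj u' w') (hu' : f u' = w') :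
    s(u', w') = s(u, w) := by
  by_contra hne
  let D := T.deleteEdges {s(u, w)}
  have hD : ∀ {x y}, D.Adj x y ↔ T.Adj x y ∧ s(x, y) ≠ s(u, w) := by
    intro x y; simp [D, deleteEdges_adj]
  have hbridge : ¬ D.Reachable u w :=
    isBridge_iff.mp (isAcyclic_iff_forall_adj_isBridge.mp hT h)
  have hmap : ∀ {x y}, D.Reachable x y → D.Reachable (f x) (f y) := by
    rintro x y ⟨p⟩
    induction p with
    | nil => rfl
    | cons hxy _ ih =>
      refine Reachable.trans (Adj.reachable ?_) ih
      rw [hD] at hxy ⊢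
      refine ⟨f.map_adj_iff.mpr hxy.1, fun heq => hxy.2 (Sym2.map.injective f.injective ?_)⟩
      rw [Sym2.map_mk, Sym2.map_mk, heq, hu, hw, Sym2.eq_swap]
  have hside : ∀ x, D.Reachable x u ∨ D.Reachable x w := by
    intro x
    obtain ⟨p⟩ := hc.preconnected x u
    induction p with
    | nil => exact Or.inl (Reachable.refl _)
    | @cons x y z hxy _ ih =>
      by_cases he : s(x, y) = s(z, w)
      · rcases Sym2.eq_iff.mp he with ⟨rfl, -⟩ | ⟨rfl, -⟩
        · exact Or.inl (Reachable.refl _)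
        · exact Or.inr (Reachable.refl _)
      · have hxy' : D.Reachable x y := (hD.mpr ⟨hxy, he⟩).reachable
        exact (ih h hu hw hne hD hbridge hmap).imp hxy'.trans hxy'.trans
  have hadj : D.Reachable u' w' := (hD.mpr ⟨h', hne⟩).reachable
  rcases hside u' with hx | hx
  · have := hmap hx
    rw [hu, hu'] at this
    exact hbridge ((hx.symm.trans hadj).trans this)
  · have := hmap hx
    rw [hw, hu'] at this
    exact hbridge ((this.symm.trans hadj.symm).trans hx)

/-- The subgraph of `T` consisting of the edges whose `G`-orbits belong to `K`. -/
def orbitSubgraph (G : Type*) {V : Type*} [Group G] [MulAction G V] (T : SimpleGraph V)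
    (K : Set (Set (Sym2 V))) : SimpleGraph V where
  Adj u w := T.Adj u w ∧ orbit G s(u, w) ∈ K
  symm := ⟨fun u w h => ⟨h.1.symm, by rw [Sym2.eq_swap]; exact h.2⟩⟩
  loopless := ⟨fun u h => T.loopless.irrefl u h.1⟩

theorem orbitSubgraph_le (T : SimpleGraph V) (K : Set (Set (Sym2 V))) :
    orbitSubgraph G T K ≤ T := fun _ _ h => h.1

theorem orbitSubgraph_adj_smul (hadj : ∀ (g : G) u v, T.Adj u v → T.Adj (g • u) (g • v))
    (K : Set (Set (Sym2 V))) (g : G) {u w : V} (h : (orbitSubgraph G T K).Adj u w) :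
    (orbitSubgraph G T K).Adj (g • u) (g • w) := by
  refine ⟨hadj g u w h.1, ?_⟩
  have : orbit G s(g • u, g • w) = orbit G s(u, w) := orbit_smul g s(u, w)
  rw [this]
  exact h.2

theorem orbitSubgraph_reachable_smul (hadj : ∀ (g : G) u v, T.Adj u v → T.Adj (g • u) (g • v))
    (K : Set (Set (Sym2 V))) (g : G) {u w : V} (h : (orbitSubgraph G T K).Reachable u w) :
    (orbitSubgraph G T K).Reachable (g • u) (g • w) := by
  obtain ⟨p⟩ := h
  induction p with
  | nil => rfl
  | cons hxy _ ih => exact (orbitSubgraph_adj_smul hadj K g hxy).reachable.trans ih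

/-- For a finitely generated group, the translates of the walks from `v` to `s • v`, where `s` runs
over a finite generating set, connect the orbit of `v` and comprise finitely many orbits of
edges. -/
theorem exists_finite_orbitSubgraph_reachable (hfg : Group.FG G) (hT : T.Connected)
    (hadj : ∀ (g : G) u v, T.Adj u v → T.Adj (g • u) (g • v)) (v : V) :
    ∃ K : Set (Set (Sym2 V)), K.Finite ∧ K ⊆ orbit G '' T.edgeSet ∧
      ∀ g : G, (orbitSubgraph G T K).Reachable v (g • v) := by
  obtain ⟨S, hS, hSfin⟩ := Group.fg_iff.mp hfg
  let p : ∀ g : G, T.Walk v (g • v) := fun g => (hT.preconnected v (g • v)).some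
  refine ⟨⋃ s ∈ S, orbit G '' {e | e ∈ (p s).edges}, ?_, ?_, ?_⟩
  · exact hSfin.biUnion fun s _ => (List.finite_toSet _).image _
  · refine Set.iUnion₂_subset fun s _ => Set.image_mono fun e he => (p s).edges_subset_edgeSet he
  · intro g
    have hg : g ∈ Subgroup.closure S := hS ▸ Subgroup.mem_top g
    induction hg using Subgroup.closure_induction with
    | mem s hs =>
      refine ⟨(p s).transfer _ fun e he => ?_⟩
      induction e with
      | _ a b =>
        exact ⟨(p s).adj_of_mem_edges he, Set.mem_biUnion hs ⟨_, he, rfl⟩⟩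
    | one => rw [one_smul]
    | mul x y _ _ hx hy =>
      rw [mul_smul]
      exact hx.trans (orbitSubgraph_reachable_smul hadj _ x hy)
    | inv x _ hx =>
      simpa using (orbitSubgraph_reachable_smul hadj _ x⁻¹ hx).symm

end Graph

/-! ### Automorphisms inverting an infinite cyclic subgroup -/

section Cyclic

variable {G : Type*} [Group G]

/-- An automorphism preserving an infinite cyclic subgroup acts on it as the identity or as
inversion. -/
theorem exists_zpowers_eq_and_apply_eq_inv (φ : MulAut G) (A : Subgroup G) [IsCyclic A]
    [Infinite A] (hA : ∀ g, φ g ∈ A ↔ g ∈ A) (hne : ¬ ∀ g ∈ A, φ g = g) :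
    ∃ t, A = Subgroup.zpowers t ∧ ¬ IsOfFinOrder t ∧ φ t = t⁻¹ := by
  obtain ⟨t, rfl⟩ := (Subgroup.isCyclic_iff_exists_zpowers_eq_top A).mp inferInstance
  have ht : ¬ IsOfFinOrder t := infinite_zpowers.mp (Set.infinite_coe_iff.mp ‹_›)
  refine ⟨t, rfl, ht, ?_⟩
  have hinj := injective_zpow_iff_not_isOfFinOrder.mpr ht
  obtain ⟨k, hk⟩ := Subgroup.mem_zpowers_iff.mp ((hA t).mpr (Subgroup.mem_zpowers t))
  obtain ⟨m, hm⟩ := Subgroup.mem_zpowers_iff.mp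
    ((hA (φ.symm t)).mp (by simp))
  have hkm : k * m = 1 := by
    apply hinj
    have : φ (t ^ m) = t := by simp [hm]
    rw [map_zpow, ← hk, ← zpow_mul] at this
    simpa using this
  -- `k` is a unit because `φ` maps the subgroup onto itself.
  rcases Int.eq_one_or_neg_one_of_mul_eq_one hkm with rfl | rfl
  · refine absurd (fun g hg => ?_) hne
    obtain ⟨n, rfl⟩ := Subgroup.mem_zpowers_iff.mp hg
    rw [map_zpow, ← hk, zpow_one]
  · rw [← hk, zpow_neg_one]

theorem eq_one_of_mem_of_apply_eq (φ : MulAut G) {A : Subgroup G} [IsCyclic A]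
    [Infinite A] (hA : ∀ g, φ g ∈ A ↔ g ∈ A) (hne : ¬ ∀ g ∈ A, φ g = g) {g : G} (hg : g ∈ A)
    (hφ : φ g = g) : g = 1 := by
  obtain ⟨t, rfl, ht, hφt⟩ := exists_zpowers_eq_and_apply_eq_inv φ A hA hne
  obtain ⟨n, rfl⟩ := Subgroup.mem_zpowers_iff.mp hg
  rw [map_zpow, hφt, inv_zpow'] at hφ
  have := injective_zpow_iff_not_isOfFinOrder.mpr ht hφ
  obtain rfl : n = 0 := by omega
  exact zpow_zero t

/-- Let `φ` invert the stabiliser `⟨t⟩` of `b`, and let `g⁻¹ * φ g = t ^ k`. Replacing `g` by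
`g * t ^ m` does not change `g • b` and changes `k` by `2 * m`, so `k` can be made `0` or `1`. -/
theorem exists_smul_eq_and_inv_mul_apply_eq (φ : MulAut G) {X : Type*} [MulAction G X] {b : X}
    {t : G} (ht : stabilizer G b = Subgroup.zpowers t) (hφt : φ t = t⁻¹) {g : G}
    (hg : g⁻¹ * φ g ∈ stabilizer G b) :
    ∃ h, h • b = g • b ∧ (h⁻¹ * φ h = 1 ∨ h⁻¹ * φ h = t) := by
  rw [ht] at hg
  obtain ⟨k, hk⟩ := Subgroup.mem_zpowers_iff.mp hg
  have hφg : φ g = g * t ^ k := by rw [hk, mul_inv_cancel_left]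
  have hstab : ∀ m : ℤ, (g * t ^ m) • b = g • b := fun m => by
    rw [mul_smul, show t ^ m • b = b from
      mem_stabilizer_iff.mp (ht ▸ Subgroup.zpow_mem_zpowers t m)]
  have hcalc : ∀ m : ℤ, (g * t ^ m)⁻¹ * φ (g * t ^ m) = t ^ (-m + k + -m) := fun m => by
    rw [map_mul, map_zpow, hφg, hφt, inv_zpow', zpow_add, zpow_add, zpow_neg]
    group
  rcases Int.even_or_odd' k with ⟨m, rfl | rfl⟩
  · exact ⟨g * t ^ m, hstab m, Or.inl (by rw [hcalc]; ring_nf; simp)⟩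
  · exact ⟨g * t ^ m, hstab m, Or.inr (by rw [hcalc]; ring_nf; simp)⟩

end Cyclic

section Encard

/-- If `g` separates at least the points of `s` that `f` separates, then `f` takes at most as many
values on `s`. -/
theorem encard_image_le_encard_image {α β γ : Type*} {s : Set α} {f : α → β} {g : α → γ}
    (h : ∀ x ∈ s, ∀ y ∈ s, g x = g y → f x = f y) : (f '' s).encard ≤ (g '' s).encard := by
  rcases s.eq_empty_or_nonempty with rfl | ⟨a, -⟩
  · simp
  have : Nonempty α := ⟨a⟩
  have heq : f '' s ⊆ (fun c => f (Function.invFunOn g s c)) '' (g '' s) := by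
    rintro _ ⟨x, hx, rfl⟩
    have hex : ∃ y ∈ s, g y = g x := ⟨x, hx, rfl⟩
    exact ⟨g x, ⟨x, hx, rfl⟩, h _ (Function.invFunOn_mem hex) _ hx (Function.invFunOn_eq hex)⟩
  exact (Set.encard_le_encard heq).trans (Set.encard_image_le _ _)

end Encard

/-! ### The fixed subgroup of an automorphism of negative sign -/

section FixedSubgroup

variable {G V : Type*} [Group G] [MulAction G V] {T : SimpleGraph V} {φ : MulAut G} {f : T ≃g T}

theorem mem_fixedSubgroup {g : G} : g ∈ GBS.fixedSubgroup φ ↔ φ g = g := Iff.rfl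

theorem map_smul_sym2 (hf : GBS.IsEquivariant φ f) (g : G) (e : Sym2 V) :
    (g • e).map f = φ g • e.map f := by
  induction e with
  | _ u v =>
    change s(f (g • u), f (g • v)) = s(φ g • f u, φ g • f v)
    rw [hf, hf]

theorem apply_mem_stabilizer_iff (hf : GBS.IsEquivariant φ f) {v : V} (hv : f v = v) (g : G) :
    φ g ∈ stabilizer G v ↔ g ∈ stabilizer G v := by
  rw [mem_stabilizer_iff, mem_stabilizer_iff]
  nth_rw 1 [← hv]
  rw [← hf]
  nth_rw 2 [← hv]
  exact f.injective.eq_iff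

theorem apply_mem_stabilizer_sym2_iff (hf : GBS.IsEquivariant φ f) {e : Sym2 V}
    (he : e.map f = e) (g : G) : φ g ∈ stabilizer G e ↔ g ∈ stabilizer G e := by
  rw [mem_stabilizer_iff, mem_stabilizer_iff]
  nth_rw 1 [← he]
  rw [← map_smul_sym2 hf]
  nth_rw 2 [← he]
  exact (Sym2.map.injective f.injective).eq_iff

theorem eq_one_of_smul_eq (hGT : GBS.IsGBSSystem G T) (hf : GBS.IsEquivariant φ f)
    (hid : ¬ GBS.IsIdOnStabilizer φ f) {v : V} (hv : f v = v) {g : G} (hg : φ g = g)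
    (hgv : g • v = v) : g = 1 := by
  have := hGT.vertex_cyclic v
  have := hGT.vertex_infinite v
  exact eq_one_of_mem_of_apply_eq φ (apply_mem_stabilizer_iff hf hv)
    (fun h => hid (Or.inl ⟨v, hv, h⟩)) (mem_stabilizer_iff.mpr hgv) hg

theorem eq_one_of_smul_sym2_eq (hGT : GBS.IsGBSSystem G T) (hf : GBS.IsEquivariant φ f)
    (hid : ¬ GBS.IsIdOnStabilizer φ f) {e : Sym2 V} (he : e ∈ T.edgeSet) (hfe : e.map f = e)
    {g : G} (hg : φ g = g) (hge : g • e = e) : g = 1 := by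
  have := hGT.edge_cyclic e he
  have := hGT.edge_infinite e he
  exact eq_one_of_mem_of_apply_eq φ (apply_mem_stabilizer_sym2_iff hf hfe)
    (fun h => hid (Or.inr ⟨e, he, hfe, h⟩)) (mem_stabilizer_iff.mpr hge) hg

/-- Each `G`-orbit of edges contains at most two `Fix(φ)`-orbits of edges fixed by `f`: if `f` fixes
`b` and `g • b`, then `g⁻¹ * φ g` lies in the stabiliser of `b`, and the `Fix(φ)`-orbit of `g • b`
depends only on the class of this element modulo squares. The colour of an edge tells whether it
belongs to the `Fix(φ)`-orbit of a base edge. -/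
theorem exists_colour_fixed_edges (hGT : GBS.IsGBSSystem G T) (hf : GBS.IsEquivariant φ f)
    (hid : ¬ GBS.IsIdOnStabilizer φ f) :
    ∃ c : Sym2 V → Bool, ∀ e ∈ T.edgeSet, ∀ e' ∈ T.edgeSet, e.map f = e → e'.map f = e' →
      orbit G e = orbit G e' → c e = c e' → ∃ h, φ h = h ∧ h • e = e' := by
  classical
  rcases isEmpty_or_nonempty (Sym2 V) with hV | hV
  · exact ⟨fun _ => true, fun e => isEmptyElim e⟩
  let Q : Set (Sym2 V) → Sym2 V → Prop := fun o e => e ∈ o ∧ e ∈ T.edgeSet ∧ e.map f = e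
  let base : Set (Sym2 V) → Sym2 V := fun o => Classical.epsilon (Q o)
  refine ⟨fun e => decide (∃ h, φ h = h ∧ h • base (orbit G e) = e), ?_⟩
  intro e he e' he' hfe hfe' horb hc
  have hbase : Q (orbit G e) (base (orbit G e)) :=
    Classical.epsilon_spec (p := Q (orbit G e)) ⟨e, mem_orbit_self e, he, hfe⟩
  simp only [← horb, decide_eq_decide] at hc
  generalize base (orbit G e) = b at hbase hc
  obtain ⟨hbo, hb, hfb⟩ := hbase
  have := hGT.edge_cyclic b hb
  have := hGT.edge_infinite b hb
  obtain ⟨t, ht, -, hφt⟩ := exists_zpowers_eq_and_apply_eq_inv φ (stabilizer G b)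
    (apply_mem_stabilizer_sym2_iff hf hfb) (fun h => hid (Or.inr ⟨b, hb, hfb, h⟩))
  have hmem : ∀ d : Sym2 V, d.map f = d → d ∈ orbit G b →
      ∃ h, h • b = d ∧ (h⁻¹ * φ h = 1 ∨ h⁻¹ * φ h = t) := by
    rintro _ hd ⟨g, rfl⟩
    refine exists_smul_eq_and_inv_mul_apply_eq φ ht hφt (mem_stabilizer_iff.mpr ?_)
    rw [mul_smul, inv_smul_eq_iff]
    change (g • b).map f = g • b at hd
    rwa [map_smul_sym2 hf, hfb] at hd
  have hob : orbit G e = orbit G b := (orbit_eq_iff.mpr hbo).symm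
  obtain ⟨h, rfl, hh⟩ := hmem e hfe (hob ▸ mem_orbit_self e)
  obtain ⟨h', rfl, hh'⟩ := hmem e' hfe' (hob ▸ horb ▸ mem_orbit_self e')
  -- Elements with the same value of `h⁻¹ * φ h` differ by an element of `Fix(φ)` on the left.
  have hfix : h⁻¹ * φ h = h'⁻¹ * φ h' → φ (h' * h⁻¹) = h' * h⁻¹ := by
    intro heq
    rw [map_mul, map_inv, ← mul_inv_cancel_left h' (φ h'), ← heq]
    group
  by_cases heq : h⁻¹ * φ h = h'⁻¹ * φ h'
  · exact ⟨h' * h⁻¹, hfix heq, by simp [mul_smul]⟩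
  · have h1 : ∀ k : G, k⁻¹ * φ k = 1 → φ k = k := fun k hk => (inv_mul_eq_one.mp hk).symm
    -- One of the two values is trivial, so one edge has the colour of the base edge, and
    -- then so does the other.
    have hboth : (∃ k, φ k = k ∧ k • b = h • b) ∧ ∃ k, φ k = k ∧ k • b = h' • b := by
      rcases hh with hh | hh
      · have : ∃ k, φ k = k ∧ k • b = h • b := ⟨h, h1 h hh, rfl⟩
        exact ⟨this, hc.mp this⟩
      · rcases hh' with hh' | hh'
        · have : ∃ k, φ k = k ∧ k • b = h' • b := ⟨h', h1 h' hh', rfl⟩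
          exact ⟨hc.mpr this, this⟩
        · exact absurd (hh.trans hh'.symm) heq
    obtain ⟨⟨k, hk, hkb⟩, k', hk', hkb'⟩ := hboth
    exact ⟨k' * k⁻¹, by rw [map_mul, map_inv, hk, hk'], by rw [← hkb, ← hkb']; simp [mul_smul]⟩

/-- The vertices fixed by `f` that are connected to `v` in the subgraph given by `K`, with the
action of `Fix(φ)`. -/
def fixedVertices (hf : GBS.IsEquivariant φ f)
    (hadj : ∀ (g : G) u v, T.Adj u v → T.Adj (g • u) (g • v)) {K : Set (Set (Sym2 V))} {v : V}
    (hK : ∀ g : G, (orbitSubgraph G T K).Reachable v (g • v)) :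
    SubMulAction (GBS.fixedSubgroup φ) V where
  carrier := {w | f w = w ∧ (orbitSubgraph G T K).Reachable v w}
  smul_mem' := by
    rintro ⟨g, hg⟩ w ⟨hw, hr⟩
    refine ⟨?_, (hK g).trans (orbitSubgraph_reachable_smul hadj K g hr)⟩
    change f (g • w) = g • w
    rw [hf, hw, mem_fixedSubgroup.mp hg]

/-- If `f` fixes a vertex, `Fix(φ)` acts freely and without inversions on the subtree of
vertices fixed by `f` that are reachable in a cocompact `G`-invariant subgraph. -/
theorem isFreeGroup_and_fg_of_fixed_vertex (hGT : GBS.IsGBSSystem G T)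
    (hf : GBS.IsEquivariant φ f) (hid : ¬ GBS.IsIdOnStabilizer φ f) {v : V} (hv : f v = v) :
    IsFreeGroup (GBS.fixedSubgroup φ) ∧ ∃ S : Set (GBS.fixedSubgroup φ), S.Finite ∧
      Subgroup.closure S = ⊤ ∧ S.encard ≤ 2 * GBS.numQuotientEdges G T := by
  obtain ⟨K, hKfin, hKT, hK⟩ :=
    exists_finite_orbitSubgraph_reachable hGT.fg hGT.isTree.connected hGT.adj_smul v
  let D := orbitSubgraph G T K
  let W := fixedVertices hf hGT.adj_smul hK
  let Y : SimpleGraph W := D.comap Subtype.val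
  have hDT : D ≤ T := orbitSubgraph_le T K
  have hconn : Y.Connected := by
    refine connected_iff_exists_forall_reachable _ |>.mpr ⟨⟨v, hv, Reachable.refl v⟩, ?_⟩
    rintro ⟨w, hw, hr⟩
    classical
    obtain ⟨p, hp⟩ := hr.exists_isPath
    have hp' : (p.mapLe hDT).IsPath := hp.mapLe hDT
    exact ⟨p.induce (W : Set V) fun x hx =>
      ⟨apply_eq_of_mem_path_support hGT.isTree.isAcyclic f hv hw hp' (by simpa using hx),
        ⟨p.takeUntil x hx⟩⟩⟩
  have hY : Y.IsTree :=
    ⟨hconn, (hGT.isTree.isAcyclic.anti hDT).of_comap (Function.Embedding.subtype _)⟩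
  have hfree : ∀ (g : GBS.fixedSubgroup φ) (w : W), g • w = w → g = 1 := by
    rintro ⟨g, hg⟩ w h
    exact Subtype.ext (eq_one_of_smul_eq hGT hf hid w.2.1 hg (congrArg Subtype.val h))
  have hfixed : ∀ e : Sym2 W, (e.map Subtype.val).map f = e.map Subtype.val := by
    intro e
    induction e with
    | _ a b => exact congrArg₂ (fun x y => s(x, y)) a.2.1 b.2.1
  have hedge : ∀ e ∈ Y.edgeSet,
      e.map Subtype.val ∈ T.edgeSet ∧ orbit G (e.map (Subtype.val : W → V)) ∈ K := by
    intro e he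
    induction e with
    | _ a b => exact he
  have hinv : ∀ (g : GBS.fixedSubgroup φ) (a b : W), Y.Adj a b → g • a = b → g • b ≠ a := by
    rintro ⟨g, hg⟩ a b hab h₁ h₂
    have hg1 : g = 1 := by
      refine eq_one_of_smul_sym2_eq hGT hf hid (hedge s(a, b) hab).1 (hfixed s(a, b)) hg ?_
      change s(g • (a : V), g • (b : V)) = s((a : V), (b : V))
      rw [show g • (a : V) = b from congrArg Subtype.val h₁,
        show g • (b : V) = a from congrArg Subtype.val h₂, Sym2.eq_swap]
    subst hg1
    exact hab.ne (by rw [← h₁]; exact (one_smul _ a).symm)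
  have hadj : ∀ (g : GBS.fixedSubgroup φ) (a b : W), Y.Adj a b → Y.Adj (g • a) (g • b) :=
    fun g a b h => orbitSubgraph_adj_smul hGT.adj_smul K (g : G) h
  refine ⟨isFreeGroup_of_free_action hY hadj hfree hinv, ?_⟩
  obtain ⟨S, hS, hcard⟩ := exists_closure_eq_top_of_free_action hconn hfree
  obtain ⟨c, hc⟩ := exists_colour_fixed_edges hGT hf hid
  have hcount : GBS.numQuotientEdges (GBS.fixedSubgroup φ) Y ≤
      (K ×ˢ (Set.univ : Set Bool)).encard := by
    let col : Sym2 W → Set (Sym2 V) × Bool :=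
      fun e => (orbit G (e.map Subtype.val), c (e.map Subtype.val))
    calc GBS.numQuotientEdges (GBS.fixedSubgroup φ) Y ≤ (col '' Y.edgeSet).encard := by
          refine encard_image_le_encard_image fun e he e' he' h => ?_
          obtain ⟨h₁, h₂⟩ := Prod.mk.injEq .. ▸ h
          obtain ⟨g, hg, hge⟩ := hc _ (hedge e he).1 _ (hedge e' he').1 (hfixed e) (hfixed e') h₁ h₂
          refine (orbit_eq_iff.mpr ⟨⟨g, hg⟩, ?_⟩).symm
          refine Sym2.map.injective Subtype.val_injective (Eq.trans ?_ hge)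
          induction e with
          | _ a b => rfl
      _ ≤ (K ×ˢ (Set.univ : Set Bool)).encard := by
          refine Set.encard_le_encard ?_
          rintro _ ⟨e, he, rfl⟩
          exact ⟨(hedge e he).2, trivial⟩
  have hfin : S.Finite := by
    rw [← Set.encard_ne_top_iff]
    exact ne_top_of_le_ne_top (Set.encard_ne_top_iff.mpr (hKfin.prod Set.finite_univ))
      (hcard.trans hcount)
  refine ⟨S, hfin, hS, (hcard.trans hcount).trans ?_⟩
  rw [Set.encard_prod, mul_comm, Set.encard_univ, ENat.card_eq_coe_fintype_card,
    Fintype.card_bool, Nat.cast_ofNat]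
  exact mul_le_mul_right (Set.encard_le_encard hKT) _

/-- If `f` inverts an edge, then `Fix(φ)` preserves this edge, so it is trivial. -/
theorem fixedSubgroup_eq_bot_of_inverted (hGT : GBS.IsGBSSystem G T)
    (hf : GBS.IsEquivariant φ f) (hid : ¬ GBS.IsIdOnStabilizer φ f) {u w : V} (h : T.Adj u w)
    (hu : f u = w) (hw : f w = u) : GBS.fixedSubgroup φ = ⊥ := by
  rw [eq_bot_iff]
  intro g hg
  rw [mem_fixedSubgroup] at hg
  refine Subgroup.mem_bot.mpr (eq_one_of_smul_sym2_eq hGT hf hid (e := s(u, w)) h ?_ hg ?_)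
  · rw [Sym2.map_mk, hu, hw, Sym2.eq_swap]
  · exact eq_of_inverted hGT.isTree.isAcyclic hGT.isTree.connected f h hu hw (hGT.adj_smul g u w h)
      (by rw [hf, hg, hu])

end FixedSubgroup

end TreeAction

theorem mainTheorem9 {G V : Type*} [Group G] [MulAction G V] (T : SimpleGraph V)
    (hGT : GBS.IsGBSSystem G T) (φ : MulAut G) (f : T ≃g T) (hf : GBS.IsEquivariant φ f)
    (hsgn : GBS.sgn φ f = some (-1)) :
    IsFreeGroup (GBS.fixedSubgroup φ) ∧
      ∃ _ : Group.FG (GBS.fixedSubgroup φ),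
        (Group.rank (GBS.fixedSubgroup φ) : ℕ∞) ≤ 2 * GBS.numQuotientEdges G T := by
  have hfix : GBS.FixesPoint f := by
    by_contra h
    simp [GBS.sgn, h] at hsgn
  have hid : ¬ GBS.IsIdOnStabilizer φ f := by
    intro h
    simp only [GBS.sgn, hfix, h, if_true, Option.some.injEq] at hsgn
    exact absurd hsgn (by decide)
  suffices h : IsFreeGroup (GBS.fixedSubgroup φ) ∧ ∃ S : Set (GBS.fixedSubgroup φ), S.Finite ∧
      Subgroup.closure S = ⊤ ∧ S.encard ≤ 2 * GBS.numQuotientEdges G T by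
    obtain ⟨hfree, S, hfin, hS, hcard⟩ := h
    refine ⟨hfree, Group.fg_iff.mpr ⟨S, hS, hfin⟩, le_trans ?_ hcard⟩
    rw [hfin.encard_eq_coe_toFinset_card]
    exact_mod_cast @Group.rank_le _ _ (_) hfin.toFinset (by simpa using hS)
  rcases hfix with ⟨v, hv⟩ | ⟨e, he, hfe⟩
  · exact TreeAction.isFreeGroup_and_fg_of_fixed_vertex hGT hf hid hv
  · induction e with
    | _ u w =>
      rcases Sym2.eq_iff.mp hfe with ⟨hu, -⟩ | ⟨hu, hw⟩
      · exact TreeAction.isFreeGroup_and_fg_of_fixed_vertex hGT hf hid hu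
      · have hbot := TreeAction.fixedSubgroup_eq_bot_of_inverted hGT hf hid he hu hw
        have : Subsingleton (GBS.fixedSubgroup φ) := by rw [hbot]; infer_instance
        refine ⟨(FreeGroupBasis.ofRepr (ι := Empty) ?_).isFreeGroup, ∅, Set.finite_empty,
          Subsingleton.elim _ _, by simp⟩
        let _ : Unique (GBS.fixedSubgroup φ) := ⟨⟨1⟩, fun _ => Subsingleton.elim _ _⟩
        exact MulEquiv.ofUnique
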